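/- Let $n\ge 0$ and let $M$ be a (Hausdorff) second-countable smooth manifold of dimension $n$, without boundary. Let $C^\infty(M)$ be the ring of smooth real-valued functions on $M$ and let $\Gamma(TM)$ be the set of smooth vector fields on $M$, i.e. of smooth sections of the tangent bundle $TM$, regarded as a $C^\infty(M)$-module under pointwise operations. Then $\Gamma(TM)$ is a finitely generated $C^\infty(M)$-module. More precisely, it is generated by $n(n+1)$ elements: there are smooth vector fields $X_1,\dots,X_{n(n+1)}$ on $M$ such that for every $Y\in\Gamma(TM)$ there exist $f_1,\dots,f_{n(n+1)}\in C^\infty(M)$ with $$Y=\sum_{i=1}^{n(n+1)} f_i X_i .$$ -/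

import Mathlib

open scoped Manifold ContDiff

namespace ContMDiffSection

section ModuleOverFunctions

variable {𝕜 : Type*} [NontriviallyNormedField 𝕜]
  {E : Type*} [NormedAddCommGroup E] [NormedSpace 𝕜 E]
  {H : Type*} [TopologicalSpace H] {I : ModelWithCorners 𝕜 E H}
  {M : Type*} [TopologicalSpace M] [ChartedSpace H M]
  {F : Type*} [NormedAddCommGroup F] [NormedSpace 𝕜 F] {k : WithTop ℕ∞}
  {V : M → Type*} [TopologicalSpace (Bundle.TotalSpace F V)]
  [∀ x : M, TopologicalSpace (V x)] [FiberBundle F V]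
  [∀ x, AddCommGroup (V x)] [∀ x, Module 𝕜 (V x)] [VectorBundle 𝕜 F V]

/-- A `C^k` function acts on a `C^k` section by pointwise multiplication: `(f • s) x = f x • s x`. -/
instance instSMulFunction : SMul C^k⟮I, M; 𝓘(𝕜, 𝕜), 𝕜⟯ Cₛ^k⟮I; F, V⟯ :=
  ⟨fun f s => ⟨fun x => f x • s x, ContMDiff.smul_section f.contMDiff s.contMDiff⟩⟩

@[simp]
theorem function_smul_apply (f : C^k⟮I, M; 𝓘(𝕜, 𝕜), 𝕜⟯) (s : Cₛ^k⟮I; F, V⟯) (x : M) :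
    (f • s) x = f x • s x :=
  rfl

/-- The `C^k` sections of a vector bundle form a module over the ring of `C^k` functions on the
base, under pointwise multiplication. -/
instance instModuleFunction : Module C^k⟮I, M; 𝓘(𝕜, 𝕜), 𝕜⟯ Cₛ^k⟮I; F, V⟯ where
  smul_add f s t := by ext x; exact smul_add (f x) (s x) (t x)
  add_smul f g s := by ext x; exact add_smul (f x) (g x) (s x)
  mul_smul f g s := by ext x; exact mul_smul (f x) (g x) (s x)
  one_smul s := by ext x; exact one_smul 𝕜 (s x)
  zero_smul s := by ext x; exact zero_smul 𝕜 (s x)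
  smul_zero f := by ext x; exact smul_zero (f x)

end ModuleOverFunctions

end ContMDiffSection

/-- The ring of smooth real-valued functions on an `n`-dimensional manifold `M`. -/
abbrev SmoothFunctions (n : ℕ) (M : Type*) [TopologicalSpace M]
    [ChartedSpace (EuclideanSpace ℝ (Fin n)) M] : Type _ :=
  C^∞⟮𝓡 n, M; 𝓘(ℝ, ℝ), ℝ⟯

/-- The smooth vector fields on an `n`-dimensional smooth manifold `M`: the smooth sections of its
tangent bundle. -/
abbrev SmoothVectorFields (n : ℕ) (M : Type*) [TopologicalSpace M]
    [ChartedSpace (EuclideanSpace ℝ (Fin n)) M] [IsManifold (𝓡 n) ∞ M] : Type _ :=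
  Cₛ^∞⟮𝓡 n; EuclideanSpace ℝ (Fin n), (TangentSpace (𝓡 n) : M → Type _)⟯

open MeasureTheory Set Filter Topology Function

/-! If an open set is a disjoint union of pieces of chart domains, its local coordinate frames glue
to a frame of `n` fields on it. So it suffices to cover `M` by `n + 1` such sets: with a subordinate
partition of unity `ρ k`, cutting off the frames gives `n` global fields generating each `ρ k ^ 2 •
Y`, and dividing by `∑ k, ρ k ^ 2` recovers `Y`.

For the cover, take a locally finite family of bump functions `f i` and generic levels `c i`. More
than `n` of the `f i` map `M` onto a null set, so at most `n` equalities `f i x = c i` hold at any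
point. Stratify `M` by the number of equalities, from `0` to `n`. Along a stratum the signs of `f i
- c i` are locally constant, hence so is a chart chosen from them; its level sets thicken to
disjoint open sets. -/

/-- A smooth map from an `n`-manifold into a coordinate space of larger dimension has a null range. -/
theorem ContMDiff.volume_range_eq_zero {n : ℕ} {M : Type*} [TopologicalSpace M]
    [SecondCountableTopology M] [ChartedSpace (EuclideanSpace ℝ (Fin n)) M]
    [IsManifold (𝓡 n) ∞ M] {κ : Type*} [Fintype κ] (hκ : n < Fintype.card κ)
    {F : M → κ → ℝ} (hF : ContMDiff (𝓡 n) 𝓘(ℝ, κ → ℝ) ∞ F) :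
    volume (range F) = 0 := by
  obtain ⟨t, htc, ht⟩ := countable_cover_nhds_interior
    (fun x : M => (chartAt (EuclideanSpace ℝ (Fin n)) x).open_source.mem_nhds (mem_chart_source _ x))
  have hsub : range F ⊆ ⋃ x ∈ t, (F ∘ (extChartAt (𝓡 n) x).symm) '' (extChartAt (𝓡 n) x).target := by
    rintro _ ⟨y, rfl⟩
    obtain ⟨x, hx, hy⟩ := mem_iUnion₂.1 (ht.ge (mem_univ y))
    have hy' : y ∈ (extChartAt (𝓡 n) x).source := by
      rw [extChartAt_source]; exact interior_subset hy
    exact mem_iUnion₂.2 ⟨x, hx, _, (extChartAt (𝓡 n) x).map_source hy',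
      congrArg F ((extChartAt (𝓡 n) x).left_inv hy')⟩
  refine measure_mono_null hsub ((measure_biUnion_null_iff htc).2 fun x _ => ?_)
  have hopen : IsOpen (extChartAt (𝓡 n) x).target := isOpen_extChartAt_target x
  have hsm : ContDiffOn ℝ ∞ (F ∘ (extChartAt (𝓡 n) x).symm) (extChartAt (𝓡 n) x).target :=
    (hF.comp_contMDiffOn (contMDiffOn_extChartAt_symm x)).contDiffOn
  -- Locally Lipschitz maps do not raise Hausdorff dimension.
  have hdim : dimH ((F ∘ (extChartAt (𝓡 n) x).symm) '' (extChartAt (𝓡 n) x).target) ≤ n := by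
    refine (dimH_image_le_of_locally_lipschitzOn fun y hy => ?_).trans
      ((dimH_mono (subset_univ _)).trans_eq ?_)
    · obtain ⟨C, u, hu, h⟩ := ((hsm.contDiffAt (hopen.mem_nhds hy)).of_le
        (by simp : (1 : WithTop ℕ∞) ≤ ∞)).exists_lipschitzOnWith
      exact ⟨C, u, nhdsWithin_le_nhds hu, h⟩
    · simp [Real.dimH_univ_eq_finrank]
  rw [← hausdorffMeasure_pi_real]
  have := hausdorffMeasure_of_dimH_lt (d := (Fintype.card κ : NNReal))
    (hdim.trans_lt (by simpa using hκ))
  simpa using this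

/-- Given countably many smooth functions on an `n`-manifold, one can choose levels in `(0, 1)`
such that no more than `n` of the level sets have a common point. -/
theorem exists_levels_card_le {n : ℕ} {M : Type*} [TopologicalSpace M]
    [SecondCountableTopology M] [ChartedSpace (EuclideanSpace ℝ (Fin n)) M]
    [IsManifold (𝓡 n) ∞ M] {ι : Type*} [Countable ι] {f : ι → M → ℝ}
    (hf : ∀ i, ContMDiff (𝓡 n) 𝓘(ℝ, ℝ) ∞ (f i)) :
    ∃ c : ι → ℝ, (∀ i, c i ∈ Ioo (0 : ℝ) 1) ∧
      ∀ x, ∀ s : Finset ι, (∀ i ∈ s, f i x = c i) → s.card ≤ n := by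
  have hprob : IsProbabilityMeasure (volume.restrict (Ioo (0 : ℝ) 1)) := ⟨by simp⟩
  -- Independent uniform levels: each of the countably many conditions holds almost surely, so some
  -- choice meets them all.
  let μ := Measure.infinitePi fun _ : ι => volume.restrict (Ioo (0 : ℝ) 1)
  have h1 : ∀ᵐ c ∂μ, ∀ i, c i ∈ Ioo (0 : ℝ) 1 := by
    refine ae_all_iff.2 fun i => ?_
    refine ae_of_ae_map (f := fun c : ι → ℝ => c i) (p := fun y => y ∈ Ioo (0 : ℝ) 1)
      (measurable_pi_apply i).aemeasurable ?_
    rw [show μ.map (fun c => c i) = volume.restrict (Ioo 0 1) from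
      Measure.infinitePi_map_eval _ i]
    exact ae_restrict_mem measurableSet_Ioo
  have h2 : ∀ᵐ c ∂μ, ∀ s : Finset ι, n < s.card →
      Finset.restrict (π := fun _ => ℝ) s c ∉ range (fun x (i : s) => f i x) := by
    refine ae_all_iff.2 fun s => ?_
    by_cases hs : n < s.card
    · have hnull : volume (range (fun x (i : s) => f i x)) = 0 :=
        ContMDiff.volume_range_eq_zero (n := n) (by simpa using hs)
          (contMDiff_pi_space.2 fun i => hf i)
      have hae : ∀ᵐ y ∂μ.map (Finset.restrict (π := fun _ => ℝ) s),
          y ∉ range (fun x (i : s) => f i x) := by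
        rw [Measure.infinitePi_map_restrict,
          ← Measure.restrict_pi_pi]
        exact ae_restrict_of_ae (measure_eq_zero_iff_ae_notMem.1 hnull)
      filter_upwards [ae_of_ae_map (Finset.measurable_restrict (X := fun _ => ℝ) s).aemeasurable hae] with c hc _
      exact hc
    · exact ae_of_all _ fun c h => absurd h hs
  obtain ⟨c, hc1, hc2⟩ := (h1.and h2).exists
  refine ⟨c, hc1, fun x s hs => ?_⟩
  by_contra! h
  exact hc2 s h ⟨x, funext fun i => hs i i.2⟩

/-- The level sets of a function that is locally constant on a subset `Z` of a metrizable space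
can be enlarged to pairwise disjoint open sets. -/
theorem exists_pairwise_disjoint_isOpen_of_eventually_eq {X : Type*} [TopologicalSpace X]
    [TopologicalSpace.MetrizableSpace X] {P : Type*} {Z : Set X} {g : X → P}
    (hg : ∀ x ∈ Z, ∀ᶠ y in 𝓝 x, y ∈ Z → g y = g x) :
    ∃ U : P → Set X, (∀ p, IsOpen (U p)) ∧ Pairwise (Disjoint on U) ∧ ∀ x ∈ Z, x ∈ U (g x) := by
  let := TopologicalSpace.metrizableSpaceMetric X
  have h : ∀ x : X, ∃ r : ℝ, 0 < r ∧ (x ∈ Z → ∀ y ∈ Z, dist y x < 2 * r → g y = g x) := by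
    intro x
    by_cases hx : x ∈ Z
    · obtain ⟨ε, hε, h⟩ := Metric.eventually_nhds_iff.1 (hg x hx)
      exact ⟨ε / 2, half_pos hε, fun _ y hy hd => h (by linarith) hy⟩
    · exact ⟨1, one_pos, fun h => absurd h hx⟩
  choose r hr h using h
  refine ⟨fun p => ⋃ x ∈ Z ∩ g ⁻¹' {p}, Metric.ball x (r x),
    fun p => isOpen_biUnion fun _ _ => Metric.isOpen_ball, fun p q hpq => ?_,
    fun x hx => mem_biUnion (⟨hx, rfl⟩ : x ∈ Z ∩ g ⁻¹' {g x}) (Metric.mem_ball_self (hr x))⟩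
  refine disjoint_left.2 fun y hyp hyq => hpq ?_
  obtain ⟨a, ⟨haZ, rfl⟩, hya⟩ := mem_iUnion₂.1 hyp
  obtain ⟨b, ⟨hbZ, rfl⟩, hyb⟩ := mem_iUnion₂.1 hyq
  rw [Metric.mem_ball] at hya hyb
  have hab := dist_triangle_left a b y
  have hba := dist_comm a b
  rcases le_total (r a) (r b) with hle | hle
  · exact h b hbZ a haZ (by linarith)
  · exact (h a haZ b hbZ (by linarith)).symm

/-- An `n`-manifold is covered by `n + 1` families of pairwise disjoint open sets, each contained
in a chart domain. -/
theorem exists_disjoint_families_subset_chart_source (n : ℕ) (M : Type*) [TopologicalSpace M]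
    [T2Space M] [SecondCountableTopology M] [ChartedSpace (EuclideanSpace ℝ (Fin n)) M]
    [IsManifold (𝓡 n) ∞ M] :
    ∃ U : Fin (n + 1) → M → Set M, (∀ k p, IsOpen (U k p)) ∧
      (∀ k, Pairwise (Disjoint on U k)) ∧
      (∀ k p, U k p ⊆ (chartAt (EuclideanSpace ℝ (Fin n)) p).source) ∧
      ∀ x, ∃ k p, x ∈ U k p := by
  have : LocallyCompactSpace M := ChartedSpace.locallyCompactSpace (EuclideanSpace ℝ (Fin n)) M
  have : TopologicalSpace.MetrizableSpace M := Manifold.metrizableSpace (𝓡 n) M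
  obtain ⟨ι, f, -⟩ := SmoothBumpCovering.exists_isSubordinate (𝓡 n) (M := M)
    (U := fun _ => univ) isClosed_univ fun _ _ => univ_mem
  have : Countable ι := countable_univ_iff.1 <| f.locallyFinite.countable_univ fun i =>
    ⟨f.c i, by simp⟩
  obtain ⟨c, hc, hcard⟩ := exists_levels_card_le (n := n) (f := fun i => f i)
    fun i => (f i).contMDiff
  have hfin : ∀ x, {i | f i x = c i}.Finite := fun x =>
    (f.point_finite x).subset fun i hi => by
      rw [mem_ofPred_eq] at hi ⊢; rw [hi]; exact (hc i).1.ne'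
  have hlt : ∀ x, ∃ i, c i < f i x := fun x =>
    ⟨f.ind x (mem_univ x), by rw [f.apply_ind x]; exact (hc _).2⟩
  have hstable : ∀ x, ∀ᶠ y in 𝓝 x, ∀ i, (c i < f i x → c i < f i y) ∧ (f i x < c i → f i y < c i) := by
    intro x
    obtain ⟨N, hN, hNfin⟩ := f.locallyFinite x
    have h : ∀ᶠ y in 𝓝 x, ∀ i ∈ {i | (support (f i) ∩ N).Nonempty},
        (c i < f i x → c i < f i y) ∧ (f i x < c i → f i y < c i) :=
      (eventually_all_finite hNfin).2 fun i _ =>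
        .and (eventually_imp_distrib_left.2 fun h =>
            (f i).continuous.continuousAt.eventually (lt_mem_nhds h))
          (eventually_imp_distrib_left.2 fun h =>
            (f i).continuous.continuousAt.eventually (gt_mem_nhds h))
    filter_upwards [h, hN] with y hy hyN i
    by_cases hi : (support (f i) ∩ N).Nonempty
    · exact hy i hi
    · have h0 : ∀ z ∈ N, f i z = 0 := fun z hz => by
        by_contra h; exact hi ⟨z, h, hz⟩
      rw [h0 y hyN, h0 x (mem_of_mem_nhds hN)]
      exact ⟨id, id⟩
  -- The choice depends on `x` only through the set `{i | c i < f i x}`, so equal sets give equal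
  -- indices.
  let g : M → ι := fun x => @Classical.epsilon ι (hlt x).nonempty fun i => i ∈ {i | c i < f i x}
  have hgspec : ∀ x, c (g x) < f (g x) x := fun x =>
    @Classical.epsilon_spec_aux ι (hlt x).nonempty (fun i => i ∈ {i | c i < f i x}) (hlt x)
  have hgconst : ∀ k : Fin (n + 1), ∀ x ∈ {x | {i | f i x = c i}.ncard = k},
      ∀ᶠ y in 𝓝 x, y ∈ {x | {i | f i x = c i}.ncard = k} → f.c (g y) = f.c (g x) := by
    intro k x hx
    filter_upwards [hstable x] with y hy hyk
    change _ = _ at hx hyk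
    -- Strict inequalities persist near `x`, so equalities can only disappear; an equal count then
    -- rules even that out.
    have hsub : {i | f i y = c i} ⊆ {i | f i x = c i} := by
      intro i hi
      rw [mem_ofPred_eq] at hi ⊢
      by_contra hne
      rcases lt_or_gt_of_ne hne with h | h
      · exact ((hy i).2 h).ne hi
      · exact ((hy i).1 h).ne' hi
    have heq := Set.eq_of_subset_of_ncard_le hsub (by rw [hx, hyk]) (hfin x)
    have hpos : {i | c i < f i y} = {i | c i < f i x} := by
      ext i
      refine ⟨fun h => ?_, (hy i).1⟩
      rw [mem_ofPred_eq] at h ⊢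
      by_contra hle
      rcases lt_or_eq_of_le (not_lt.1 hle) with h' | h'
      · exact h.not_gt ((hy i).2 h')
      · exact h.ne' (heq.ge h')
    simp only [g, hpos]
  choose U hUo hUd hU using fun k =>
    exists_pairwise_disjoint_isOpen_of_eventually_eq (hgconst k)
  refine ⟨fun k p => U k p ∩ (chartAt _ p).source,
    fun k p => (hUo k p).inter (chartAt _ p).open_source,
    fun k p q hpq => (hUd k hpq).mono inter_subset_left inter_subset_left,
    fun k p => inter_subset_right, fun x => ?_⟩
  have hk : {i | f i x = c i}.ncard < n + 1 := by
    rw [Set.ncard_eq_toFinset_card _ (hfin x)]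
    exact Nat.lt_succ_of_le (hcard x _ fun i hi => by simpa using hi)
  refine ⟨⟨_, hk⟩, f.c (g x), hU ⟨_, hk⟩ x rfl, (f (g x)).support_subset_source ?_⟩
  exact ((hc _).1.trans (hgspec x)).ne'

/-- If a smooth function `ρ` is supported in a union of disjoint open subsets of chart domains,
there are `n` vector fields that generate `ρ ^ 2 • Y` for every vector field `Y`. -/
theorem exists_frame_mul_cutoff {n : ℕ} {M : Type*} [TopologicalSpace M]
    [ChartedSpace (EuclideanSpace ℝ (Fin n)) M] [IsManifold (𝓡 n) ∞ M]
    {U : M → Set M} (hUo : ∀ p, IsOpen (U p)) (hUd : Pairwise (Disjoint on U))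
    (hUs : ∀ p, U p ⊆ (chartAt (EuclideanSpace ℝ (Fin n)) p).source)
    (ρ : SmoothFunctions n M) (hρ : tsupport ρ ⊆ ⋃ p, U p) :
    ∃ X : Fin n → SmoothVectorFields n M, ∀ Y : SmoothVectorFields n M,
      ∃ f : Fin n → SmoothFunctions n M, (ρ * ρ) • Y = ∑ j, f j • X j := by
  classical
  let b := (EuclideanSpace.basisFun (Fin n) ℝ).toBasis
  let e := fun p : M => trivializationAt (EuclideanSpace ℝ (Fin n)) (TangentSpace (𝓡 n)) p
  -- By disjointness, `q x` is the only `p` with `x ∈ U p`; its value off the union is irrelevant,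
  -- since `ρ` vanishes there.
  let q : M → M := fun x => @Classical.epsilon M ⟨x⟩ fun p => x ∈ U p
  have hq : ∀ {p x}, x ∈ U p → q x = p := by
    intro p x hx
    by_contra hne
    exact disjoint_left.1 (hUd hne) (Classical.epsilon_spec_aux ⟨x⟩ (fun p => x ∈ U p) ⟨p, hx⟩) hx
  have hbase : ∀ {p x}, x ∈ U p → x ∈ (e p).baseSet := by
    intro p x hx
    rw [TangentBundle.trivializationAt_baseSet]; exact hUs p hx
  have hzero : ∀ x, x ∉ ⋃ p, U p → ∀ᶠ y in 𝓝 x, ρ y = 0 := fun x hx =>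
    notMem_tsupport_iff_eventuallyEq.1 fun h => hx (hρ h)
  -- One factor `ρ` makes the frame fields globally smooth, the other the coefficients of `Y`; hence
  -- the square.
  have hX : ∀ j, ContMDiff (𝓡 n) ((𝓡 n).prod 𝓘(ℝ, EuclideanSpace ℝ (Fin n))) ∞
      (fun x => Bundle.TotalSpace.mk' (EuclideanSpace ℝ (Fin n))
        (E := (TangentSpace (𝓡 n) : M → Type _)) x (ρ x • (e (q x)).localFrame b j x)) := by
    intro j x
    by_cases hx : x ∈ ⋃ p, U p
    · obtain ⟨p, hp⟩ := mem_iUnion.1 hx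
      refine ((ρ.contMDiff x).smul_section
        (contMDiffAt_localFrame_of_mem ∞ (e p) b j (hbase hp))).congr_of_eventuallyEq ?_
      filter_upwards [(hUo p).mem_nhds hp] with y hy
      simp [hq hy]
    · refine ((0 : SmoothVectorFields n M).contMDiff x).congr_of_eventuallyEq ?_
      filter_upwards [hzero x hx] with y hy
      simp [hy]
  have hf : ∀ (Y : SmoothVectorFields n M) (j : Fin n), ContMDiff (𝓡 n) 𝓘(ℝ, ℝ) ∞
      (fun x => ρ x * (e (q x)).localFrameCoeff (𝓡 n) b j x (Y x)) := by
    intro Y j x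
    by_cases hx : x ∈ ⋃ p, U p
    · obtain ⟨p, hp⟩ := mem_iUnion.1 hx
      refine ((ρ.contMDiff x).mul
        (contMDiffAt_localFrameCoeff (e := e p) b (hbase hp) (Y.contMDiff x) j)).congr_of_eventuallyEq ?_
      filter_upwards [(hUo p).mem_nhds hp] with y hy
      simp [hq hy]
    · refine (contMDiffAt_const (c := (0 : ℝ))).congr_of_eventuallyEq ?_
      filter_upwards [hzero x hx] with y hy
      simp [hy]
  refine ⟨fun j => ⟨_, hX j⟩, fun Y => ⟨fun j => ⟨_, hf Y j⟩, ?_⟩⟩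
  ext x
  rw [← ContMDiffSection.coeAddHom_apply (s := ∑ j, _), map_sum, Finset.sum_apply]
  change (ρ x * ρ x) • Y x = ∑ j, (ρ x * (e (q x)).localFrameCoeff (𝓡 n) b j x (Y x)) •
    (ρ x • (e (q x)).localFrame b j x)
  by_cases hx : x ∈ ⋃ p, U p
  · obtain ⟨p, hp⟩ := mem_iUnion.1 hx
    rw [hq hp]
    conv_lhs => rw [(e p).eq_sum_localFrameCoeff_smul (I := 𝓡 n) (b := b) (s := Y) (hbase hp)]
    rw [Finset.smul_sum]
    refine Finset.sum_congr rfl fun j _ => ?_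
    rw [smul_smul, smul_smul]
    congr 1
    ring
  · simp [(hzero x hx).self_of_nhds]

theorem mainTheorem1 (n : ℕ) (M : Type*) [TopologicalSpace M] [T2Space M]
    [SecondCountableTopology M] [ChartedSpace (EuclideanSpace ℝ (Fin n)) M]
    [IsManifold (𝓡 n) ∞ M] :
    Module.Finite (SmoothFunctions n M) (SmoothVectorFields n M) ∧
    ∃ X : Fin (n * (n + 1)) → SmoothVectorFields n M,
      ∀ Y : SmoothVectorFields n M, ∃ f : Fin (n * (n + 1)) → SmoothFunctions n M,
        Y = ∑ i, f i • X i := by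
  have hgen : ∃ X : Fin (n * (n + 1)) → SmoothVectorFields n M,
      ∀ Y : SmoothVectorFields n M, ∃ f : Fin (n * (n + 1)) → SmoothFunctions n M,
        Y = ∑ i, f i • X i := by
    have : LocallyCompactSpace M := ChartedSpace.locallyCompactSpace (EuclideanSpace ℝ (Fin n)) M
    obtain ⟨U, hUo, hUd, hUs, hU⟩ := exists_disjoint_families_subset_chart_source n M
    obtain ⟨ρ, hρ⟩ := SmoothPartitionOfUnity.exists_isSubordinate (𝓡 n) (M := M) isClosed_univ
      (fun k => ⋃ p, U k p) (fun k => isOpen_iUnion (hUo k))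
      fun x _ => by simpa using hU x
    choose X hX using fun k => exists_frame_mul_cutoff (hUo k) (hUd k) (hUs k) (ρ k) (hρ k)
    have hne : ∀ x, ∑ k, ρ k x * ρ k x ≠ 0 := by
      intro x h
      obtain ⟨k, hk⟩ := ρ.exists_pos_of_mem (mem_univ x)
      rw [Finset.sum_eq_zero_iff_of_nonneg fun k _ => mul_self_nonneg _] at h
      exact (mul_pos hk hk).ne' (h k (Finset.mem_univ k))
    let σ : SmoothFunctions n M := ⟨fun x => (∑ k, ρ k x * ρ k x)⁻¹,
      ContMDiff.inv₀ (contMDiff_finsetSum fun k _ => (ρ k).contMDiff.mul (ρ k).contMDiff) hne⟩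
    have hσ : σ * ∑ k, ρ k * ρ k = 1 := by
      ext x
      rw [ContMDiffMap.coe_mul, Pi.mul_apply, ← ContMDiffMap.coeFnAddMonoidHom_apply (∑ k, _),
        map_sum, Finset.sum_apply]
      exact inv_mul_cancel₀ (hne x)
    refine ⟨fun i => X (finProdFinEquiv.symm i).2 (finProdFinEquiv.symm i).1, fun Y => ?_⟩
    choose f hf using fun k => hX k Y
    refine ⟨fun i => σ * f (finProdFinEquiv.symm i).2 (finProdFinEquiv.symm i).1, ?_⟩
    rw [finProdFinEquiv.symm.sum_comp fun i : Fin n × Fin (n + 1) =>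
      (σ * f i.2 i.1) • X i.2 i.1, Fintype.sum_prod_type_right]
    simp only [mul_smul σ, ← Finset.smul_sum, ← hf]
    rw [← Finset.sum_smul, ← mul_smul, hσ, one_smul]
  refine ⟨?_, hgen⟩
  obtain ⟨X, hX⟩ := hgen
  refine Module.Finite.of_surjective (Fintype.linearCombination (SmoothFunctions n M) X)
    fun Y => ?_
  obtain ⟨f, hf⟩ := hX Y
  exact ⟨f, hf.symm⟩
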